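/- Let $\mathbf{JCPos}$ (resp. $\mathbf{MCPos}$) be the category of small complete lattices and maps preserving arbitrary joins (resp. meets). Let $\mathbf{X}$ be the category $\mathbf{Set}$ of sets (resp. the category $\mathbf{fSet}$ of finite sets) and $S:\mathbf{X}\to\mathbf{JCPos}$ any functor; write $S_X=S(X)$ and $f_!=S(f)$. Let $T:\mathbf{X}^{op}\to\mathbf{MCPos}$ be the associated functor, $T_X=S_X$ and $T(f)=f^*$ with $f^*(\mathcal{Y})=\bigvee\{\mathcal{X}\in S_X : f_!(\mathcal{X})\le\mathcal{Y}\}$ for $f:X\to Y$. Let $\mathbf{A}=\mathbf{X}_S$ be the category whose objects are the pairs $(X,\mathcal{X})$ with $X$ an object of $\mathbf{X}$ and $\mathcal{X}\in S_X$, and whose morphisms $(X,\mathcal{X})\to(Y,\mathcal{Y})$ are the $\mathbf{X}$-morphisms $f:X\to Y$ with $f_!(\mathcal{X})\le\mathcal{Y}$, and let $U:\mathbf{A}\to\mathbf{X}$ be the forgetful functor. A source $(f_i:A\to A_i)_{i\in I}$ in $\mathbf{A}$ (a family of morphisms with common domain, indexed by a possibly empty set or class) is initial if every $\mathbf{X}$-morphism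 $g:UB\to UA$ such that all $Uf_i\circ g$ are (underlying) $\mathbf{A}$-morphisms $B\to A_i$ is an $\mathbf{A}$-morphism $B\to A$; it is a mono-source if $f_i r=f_i s$ for all $i$ implies $r=s$; a mono-source is extremal if, whenever $f_i=g_i e$ for all $i$ with $e$ epi, $e$ is an isomorphism. Final sinks are defined dually to initial sources, and extremal monomorphisms are the monomorphisms which are extremal as one-element sources; extremal epimorphisms are dual. $\mathbf{A}$ is an $(E,M)$-category, for $E$ a class of morphisms and $M$ a collection of sources, if $E$ and $M$ are closed under composition with isomorphisms, every source factors as $(m_i\circ e)_i$ with $e\in E$ and $(m_i)_i\in M$, and whenever $e:A\to B$ is in $E$, $(m_i:C\to D_i)_i$ is in $M$ and $g_i e=m_i f$ for all $i$, there is a unique $d:B\to C$ with $de=f$ and $m_i d=g_i$ for all $i$; for $M$ a class of morphisms the notion is the same with single morphisms in place of sources. Then the following hold. 1. $\mathbf{A}$ is complete and cocomplete (resp. finitely complete and finitely cocomplete). 2. $U$ has as left adjoint the discrete functor $O$, $X\mapsto(X,0_{S_X})$, and as right adjoint the indiscrete functor $I$, $X\mapsto(X,1_{S_X})$, so $U$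 preserves limits and colimits. 3. The limit of a small (resp. finite) diagram $D:\mathbf{I}\to\mathbf{A}$, $D_i=(X_i,\mathcal{X}_i)$, is the initial lift of the underlying limit: if $(l_i:|L|\to UD_i)_i$ is the limit of $UD$, then $(l_i:L\to D_i)_i$ with $L=(|L|,\bigwedge_i l_i^*(\mathcal{X}_i))$ is a limit of $D$ and an initial source; and every limit of $D$ is of this form. 4. The colimit of $D$ is the final lift of the underlying colimit: if $(c_i:UD_i\to|C|)_i$ is the colimit of $UD$, then $(c_i:D_i\to C)_i$ with $C=(|C|,\bigvee_i c_{i!}(\mathcal{X}_i))$ is a colimit of $D$ and a final sink; and every colimit of $D$ is of this form. 5. $\mathbf{A}$ is wellpowered and cowellpowered. 6. $\mathbf{A}$ is an (Epi, ExtremalMonoSource)-category. 7. $\mathbf{A}$ has regular factorizations, i.e. is a (RegEpi, MonoSource)-category; in particular it is a (RegEpi, Mono)-category. 8. In $\mathbf{A}$ the classes of embeddings (initial monomorphisms), of extremal monomorphisms and of regular monomorphisms coincide. 9. In $\mathbf{A}$ the classes of quotient morphisms (final epimorphisms), of extremal epimorphisms and of regular epimorphisms coincide. 10. $\mathbf{A}$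 has a separator and a coseparator. -/

import Mathlib

open CategoryTheory CategoryTheory.Limits

attribute [-instance] CategoryTheory.catToReflQuiver

universe w v' u' v u

namespace LatStr

/-! ### Complete lattices with join-preserving, resp. meet-preserving, maps -/

/-- The objects of the category `JCPos`: (small) complete lattices. -/
structure JCPos : Type (u + 1) where
  of ::
  carrier : Type u
  [str : CompleteLattice carrier]

attribute [instance] JCPos.str

instance : CoeSort JCPos.{u} (Type u) := ⟨JCPos.carrier⟩

/-- Morphisms of `JCPos` are the maps preserving arbitrary joins. -/
instance : LargeCategory.{u} JCPos.{u} where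
  Hom A B := sSupHom A B
  id A := sSupHom.id A
  comp f g := g.comp f

instance : ConcreteCategory JCPos.{u} (fun A B => sSupHom A B) where
  hom f := f
  ofHom f := f

/-- The objects of the category `MCPos`: (small) complete lattices. -/
structure MCPos : Type (u + 1) where
  of ::
  carrier : Type u
  [str : CompleteLattice carrier]

attribute [instance] MCPos.str

instance : CoeSort MCPos.{u} (Type u) := ⟨MCPos.carrier⟩

/-- Morphisms of `MCPos` are the maps preserving arbitrary meets. -/
instance : LargeCategory.{u} MCPos.{u} where
  Hom A B := sInfHom A B
  id A := sInfHom.id A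
  comp f g := g.comp f

instance : ConcreteCategory MCPos.{u} (fun A B => sInfHom A B) where
  hom f := f
  ofHom f := f

/-- For a join-preserving map `φ`, `x ≤ ⋁ {x' | φ x' ≤ y}` if and only if `φ x ≤ y`. -/
theorem le_sSup_iff {A B : Type*} [CompleteLattice A] [CompleteLattice B] (φ : sSupHom A B)
    (x : A) (y : B) : x ≤ sSup {x' | φ x' ≤ y} ↔ φ x ≤ y := by
  constructor
  · intro h
    refine le_trans (OrderHomClass.mono φ h) ?_
    rw [map_sSup]
    apply sSup_le
    rintro _ ⟨x', hx', rfl⟩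
    exact hx'
  · intro h
    exact le_sSup h

section Structured

variable {X : Type u'} [Category.{v'} X] (S : X ⥤ JCPos.{u})

/-- `f_! : S_X → S_Y`, the value of `S` at `f : X ⟶ Y`. -/
def push {A B : X} (f : A ⟶ B) : sSupHom (S.obj A) (S.obj B) := S.map f

theorem push_id (A : X) (x : S.obj A) : push S (𝟙 A) x = x := by
  have h : push S (𝟙 A) = sSupHom.id (S.obj A) := S.map_id A
  rw [h]; rfl

theorem push_comp {A B C : X} (f : A ⟶ B) (g : B ⟶ C) (x : S.obj A) :
    push S (f ≫ g) x = push S g (push S f x) := by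
  have h : push S (f ≫ g) = (push S g).comp (push S f) := S.map_comp f g
  rw [h]; rfl

/-- `f^* y = ⋁ {x | f_! x ≤ y}`, as a meet-preserving map `S_Y → S_X`. -/
def pull {A B : X} (f : A ⟶ B) : sInfHom (S.obj B) (S.obj A) where
  toFun y := sSup {x | push S f x ≤ y}
  map_sInf' s := by
    refine eq_of_forall_le_iff fun x => ?_
    rw [le_sSup_iff, le_sInf_iff, le_sInf_iff]
    constructor
    · rintro h _ ⟨y, hy, rfl⟩
      exact (le_sSup_iff _ _ _).2 (h y hy)
    · intro h y hy
      exact (le_sSup_iff _ _ _).1 (h _ ⟨y, hy, rfl⟩)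

theorem le_pull_iff {A B : X} (f : A ⟶ B) (x : S.obj A) (y : S.obj B) :
    x ≤ pull S f y ↔ push S f x ≤ y :=
  le_sSup_iff (push S f) x y

/-- The contravariant functor `T : Xᵒᵖ ⥤ MCPos` associated with `S`:
`T_X = S_X` and `T(f) = f^*`. -/
def assoc : Xᵒᵖ ⥤ MCPos.{u} where
  obj A := MCPos.of (S.obj A.unop)
  map f := pull S f.unop
  map_id A := by
    refine DFunLike.ext (F := sInfHom (S.obj A.unop) (S.obj A.unop)) _ _ fun y => ?_
    refine eq_of_forall_le_iff fun x => ?_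
    rw [le_pull_iff, unop_id, push_id]
    rfl
  map_comp {A B C} f g := by
    refine DFunLike.ext (F := sInfHom (S.obj A.unop) (S.obj C.unop)) _ _ fun y => ?_
    refine eq_of_forall_le_iff fun x => ?_
    rw [le_pull_iff, unop_comp, push_comp, ← le_pull_iff, ← le_pull_iff]
    rfl

/-- The objects of the category `X_S` structured by `S`: pairs of an object of `X` and an
`S`-structure on it. -/
structure Structured where
  base : X
  str : S.obj base

variable {S} in
/-- Morphisms of `X_S`: the morphisms `f` of `X` with `f_! 𝒳 ≤ 𝒴`. -/
@[ext]
structure Structured.Hom (A B : Structured S) where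
  base : A.base ⟶ B.base
  push_le : push S base A.str ≤ B.str

/-- The category `X_S` structured by `S`. -/
instance : Category.{v'} (Structured S) where
  Hom A B := Structured.Hom A B
  id A := ⟨𝟙 A.base, by rw [push_id]⟩
  comp f g := ⟨f.base ≫ g.base, by
    rw [push_comp]
    exact le_trans (OrderHomClass.mono _ f.push_le) g.push_le⟩
  id_comp f := Structured.Hom.ext (Category.id_comp f.base)
  comp_id f := Structured.Hom.ext (Category.comp_id f.base)
  assoc f g h := Structured.Hom.ext (Category.assoc f.base g.base h.base)

/-- The forgetful functor `U : X_S ⥤ X`. -/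
def forg : Structured S ⥤ X where
  obj A := A.base
  map f := f.base

instance : (forg S).Faithful where
  map_injective h := Structured.Hom.ext h

/-- The functor `O : X ⥤ X_S` which endows each object with the discrete (finest) structure. -/
def discrete : X ⥤ Structured S where
  obj A := ⟨A, ⊥⟩
  map f := ⟨f, by rw [map_bot]⟩
  map_id _ := rfl
  map_comp _ _ := rfl

/-- The functor `I : X ⥤ X_S` which endows each object with the indiscrete (coarsest)
structure. -/
def indiscrete : X ⥤ Structured S where
  obj A := ⟨A, ⊤⟩
  map f := ⟨f, le_top⟩
  map_id _ := rfl
  map_comp _ _ := rfl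

variable {J : Type w} [Category.{v} J]

/-- Given a cone `l` over the underlying diagram of `D`, the cone over `D` with the same
projections whose vertex carries the structure `⋀ i, (l_i)^* 𝒳_i`. -/
def initialLift (D : J ⥤ Structured S) (l : Cone (D ⋙ forg S)) : Cone D where
  pt := ⟨l.pt, ⨅ i, (assoc S).map (l.π.app i).op (D.obj i).str⟩
  π :=
    { app := fun i => ⟨l.π.app i, (le_pull_iff S (l.π.app i) _ _).1 (iInf_le _ i)⟩
      naturality := fun _ _ f => Structured.Hom.ext (l.π.naturality f) }

/-- Given a cocone `c` under the underlying diagram of `D`, the cocone under `D` with the same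
coprojections whose vertex carries the structure `⋁ i, (c_i)_! 𝒳_i`. -/
def finalLift (D : J ⥤ Structured S) (c : Cocone (D ⋙ forg S)) : Cocone D where
  pt := ⟨c.pt, ⨆ i, S.map (c.ι.app i) (D.obj i).str⟩
  ι :=
    { app := fun i => ⟨c.ι.app i,
        le_iSup (α := S.obj c.pt) (fun i => push S (c.ι.app i) (D.obj i).str) i⟩
      naturality := fun _ _ f => Structured.Hom.ext (c.ι.naturality f) }

end Structured

/-! ### Sources, sinks, initial and final lifts -/

section Sources

variable {C : Type u} [Category.{v} C]

/-- A source in `C`: an object with a (possibly empty, possibly large) family of morphisms out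
of it. -/
structure Source (C : Type u) [Category.{v} C] where
  dom : C
  ι : Type w
  cod : ι → C
  hom : ∀ i, dom ⟶ cod i

/-- A sink in `C`: an object with a family of morphisms into it. -/
structure Sink (C : Type u) [Category.{v} C] where
  cod : C
  ι : Type w
  dom : ι → C
  hom : ∀ i, dom i ⟶ cod

/-- The source of the projections of a cone. -/
def Source.ofCone {J : Type w} [Category.{v'} J] {D : J ⥤ C} (c : Cone D) : Source.{w} C :=
  ⟨c.pt, J, D.obj, c.π.app⟩

/-- The sink of the coprojections of a cocone. -/
def Sink.ofCocone {J : Type w} [Category.{v'} J] {D : J ⥤ C} (c : Cocone D) : Sink.{w} C :=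
  ⟨c.pt, J, D.obj, c.ι.app⟩

/-- The composite of a source with a morphism into its domain. -/
def Source.precomp (s : Source.{w} C) {A : C} (h : A ⟶ s.dom) : Source.{w} C :=
  ⟨A, s.ι, s.cod, fun i => h ≫ s.hom i⟩

/-- Mono-sources. -/
def Source.IsMono (s : Source.{w} C) : Prop :=
  ∀ ⦃B : C⦄ (p q : B ⟶ s.dom), (∀ i, p ≫ s.hom i = q ≫ s.hom i) → p = q

/-- Extremal mono-sources: mono-sources through which an epimorphism can be factored out only if
it is an isomorphism. -/
def Source.IsExtremalMono (s : Source.{w} C) : Prop :=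
  s.IsMono ∧ ∀ ⦃B : C⦄ (e : s.dom ⟶ B) (g : ∀ i, B ⟶ s.cod i), Epi e →
    (∀ i, e ≫ g i = s.hom i) → IsIso e

/-- Extremal monomorphisms. (Extremal epimorphisms are `CategoryTheory.ExtremalEpi`.) -/
def IsExtremalMono {A B : C} (m : A ⟶ B) : Prop :=
  Mono m ∧ ∀ ⦃Z : C⦄ (e : A ⟶ Z) (g : Z ⟶ B), Epi e → e ≫ g = m → IsIso e

/-- `C` is an `(E, M)`-category, where `E` is a class of morphisms and `M` a collection of
sources: both are closed under composition with isomorphisms, every source has an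
`(E, M)`-factorization, and the unique `(E, M)`-diagonalization property holds. -/
structure IsEMCategory (E : MorphismProperty C) (M : Source.{w} C → Prop) : Prop where
  comp_iso : ∀ ⦃A B B' : C⦄ (e : A ⟶ B) (h : B ⟶ B'), E e → IsIso h → E (e ≫ h)
  iso_comp : ∀ (s : Source.{w} C) ⦃A : C⦄ (h : A ⟶ s.dom), M s → IsIso h → M (s.precomp h)
  factorization : ∀ s : Source.{w} C, ∃ (B : C) (e : s.dom ⟶ B) (m : ∀ i, B ⟶ s.cod i),
    E e ∧ M ⟨B, s.ι, s.cod, m⟩ ∧ ∀ i, e ≫ m i = s.hom i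
  diagonalization : ∀ ⦃A B : C⦄ (e : A ⟶ B) (m : Source.{w} C) (f : A ⟶ m.dom)
    (g : ∀ i, B ⟶ m.cod i), E e → M m → (∀ i, e ≫ g i = f ≫ m.hom i) →
      ∃! d : B ⟶ m.dom, e ≫ d = f ∧ ∀ i, d ≫ m.hom i = g i

/-- `C` is `(E, M)`-structured (an `(E, M)`-category in the sense of morphisms), where `E` and `M`
are classes of morphisms. -/
structure IsEMStructured (E M : MorphismProperty C) : Prop where
  comp_iso : ∀ ⦃A B B' : C⦄ (e : A ⟶ B) (h : B ⟶ B'), E e → IsIso h → E (e ≫ h)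
  iso_comp : ∀ ⦃A' A B : C⦄ (h : A' ⟶ A) (m : A ⟶ B), M m → IsIso h → M (h ≫ m)
  factorization : ∀ ⦃A B : C⦄ (f : A ⟶ B), ∃ (Z : C) (e : A ⟶ Z) (m : Z ⟶ B),
    E e ∧ M m ∧ e ≫ m = f
  diagonalization : ∀ ⦃A B A' B' : C⦄ (e : A ⟶ B) (m : A' ⟶ B') (f : A ⟶ A') (g : B ⟶ B'),
    E e → M m → e ≫ g = f ≫ m → ∃! d : B ⟶ A', e ≫ d = f ∧ d ≫ m = g

variable {X : Type u'} [Category.{v'} X] (U : C ⥤ X)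

/-- A source in `C` is `U`-initial if a morphism `U B ⟶ U A` of the base into its domain `A`
lifts to `C` as soon as all its composites with the source do. -/
def Source.IsInitial (s : Source.{w} C) : Prop :=
  ∀ ⦃B : C⦄ (g : U.obj B ⟶ U.obj s.dom),
    (∀ i, ∃ h : B ⟶ s.cod i, U.map h = g ≫ U.map (s.hom i)) → ∃ h : B ⟶ s.dom, U.map h = g

/-- A sink in `C` is `U`-final if a morphism `U A ⟶ U B` of the base out of its codomain `A`
lifts to `C` as soon as all its composites with the sink do. -/
def Sink.IsFinal (s : Sink.{w} C) : Prop :=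
  ∀ ⦃B : C⦄ (g : U.obj s.cod ⟶ U.obj B),
    (∀ i, ∃ h : s.dom i ⟶ B, U.map h = U.map (s.hom i) ≫ g) → ∃ h : s.cod ⟶ B, U.map h = g

/-- Embeddings: monomorphisms which are `U`-initial (as one-element sources). -/
def IsEmbedding {A B : C} (m : A ⟶ B) : Prop :=
  Mono m ∧ Source.IsInitial.{0} U ⟨A, Unit, fun _ => B, fun _ => m⟩

/-- Quotient morphisms: epimorphisms which are `U`-final (as one-element sinks). -/
def IsQuotient {A B : C} (e : A ⟶ B) : Prop :=
  Epi e ∧ Sink.IsFinal.{0} U ⟨B, Unit, fun _ => A, fun _ => e⟩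

end Sources

end LatStr

open LatStr

/-!
The category of `S`-structured objects is topological over its base: `push f ⊣ pull f` is a Galois
connection, so a source is initial exactly when its domain carries the meet of the pulled back
structures (`isInitial_iff`), and a sink is final exactly when its codomain carries the join of the
pushed forward structures (`isFinal_iff`). Hence every limit or colimit of the base lifts, and the
forgetful functor, faithful with the discrete and indiscrete functors as adjoints, preserves and
reflects monomorphisms, epimorphisms and mono-sources. Everything else is thereby reduced to the
base, whose relevant properties are: every monomorphism and every epimorphism is regular, there are
a separator and a coseparator, and every source is an epimorphism followed by a mono-source.

* A regular epimorphism is orthogonal to every mono-source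
  (`Source.IsMono.existsUnique_diagonal`). Over such a base this gives all the diagonals; the
  middle object of a factorization carries the initial structure for (Epi, ExtremalMonoSource),
  and the final structure for (RegEpi, MonoSource).
* A regular monomorphism is extremal in any category; an extremal monomorphism is initial, as seen
  by factoring out the identity into the coarser initial structure; and an embedding is the
  equalizer of a pair which exhibits its underlying map as an equalizer, taken with indiscrete
  codomain. Quotient morphisms are treated dually.
* A subobject of `A` is determined by a subobject of the base and one of the set-many structures on
  it (`wellPowered_structured`), and likewise for quotients.

The category of sets and the category of finite sets have the required properties for a common
reason: both are full subcategories of the category of sets which are closed under quotients and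
contain a two-element set (`IsSetLike`).
-/

namespace LatStr

/-! ### Sources and factorization structures -/

section Sources

variable {C : Type u} [Category.{v} C]

theorem Source.IsMono.precomp {s : Source.{w} C} (hs : s.IsMono) {A : C} (h : A ⟶ s.dom)
    [IsIso h] : (s.precomp h).IsMono := fun _ p q hpq =>
  (cancel_mono h).1 <| hs (p ≫ h) (q ≫ h) fun i =>
    (Category.assoc p h _).trans ((hpq i).trans (Category.assoc q h _).symm)

theorem Source.IsExtremalMono.precomp {s : Source.{w} C} (hs : s.IsExtremalMono) {A : C}
    (h : A ⟶ s.dom) [IsIso h] : (s.precomp h).IsExtremalMono := by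
  refine ⟨hs.1.precomp h, fun B (e : A ⟶ B) (g : ∀ i, B ⟶ s.cod i) he heg => ?_⟩
  have he' : Epi e := he
  have hg (i) : e ≫ g i = h ≫ s.hom i := heg i
  have : IsIso (inv h ≫ e) := hs.2 (inv h ≫ e) g inferInstance fun i => by simp [hg]
  exact IsIso.of_isIso_comp_left (inv h) e

/-- Regular epimorphisms are orthogonal to mono-sources: the diagonal is induced by the universal
property of the coequalizer. -/
theorem Source.IsMono.existsUnique_diagonal {m : Source.{w} C} (hm : m.IsMono) {A B : C}
    (e : A ⟶ B) [IsRegularEpi e] (f : A ⟶ m.dom) (g : ∀ i, B ⟶ m.cod i)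
    (h : ∀ i, e ≫ g i = f ≫ m.hom i) :
    ∃! d : B ⟶ m.dom, e ≫ d = f ∧ ∀ i, d ≫ m.hom i = g i := by
  have : Epi e := (IsRegularEpi.getStruct e).epi
  have hf : IsRegularEpi.left e ≫ f = IsRegularEpi.right e ≫ f :=
    hm _ _ fun i => by simp only [Category.assoc, ← h i, reassoc_of% IsRegularEpi.w e]
  refine ⟨IsRegularEpi.desc e f hf, ⟨IsRegularEpi.fac e f hf, fun i => ?_⟩, fun d hd => ?_⟩
  · rw [← cancel_epi e, h i, IsRegularEpi.fac_assoc]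
  · exact IsRegularEpi.uniq e f hf d hd.1

theorem isMono_single_iff {A B : C} (m : A ⟶ B) :
    Source.IsMono.{w} ⟨A, PUnit, fun _ => B, fun _ => m⟩ ↔ Mono m :=
  ⟨fun h => ⟨fun p q hpq => h p q fun _ => hpq⟩, fun _ _ _ _ hpq => (cancel_mono m).1 (hpq ⟨⟩)⟩

theorem IsEMCategory.isEMStructured_monomorphisms {E : MorphismProperty C}
    (h : IsEMCategory.{w} E Source.IsMono) :
    IsEMStructured E (MorphismProperty.monomorphisms C) where
  comp_iso := h.comp_iso
  iso_comp := fun _ _ _ i m hm _ => by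
    have : Mono m := hm
    exact MorphismProperty.monomorphisms.infer_property (i ≫ m)
  factorization := fun A B f => by
    obtain ⟨Z, e, m, he, hm, hf⟩ := h.factorization ⟨A, PUnit, fun _ => B, fun _ => f⟩
    exact ⟨Z, e, m ⟨⟩, he, (isMono_single_iff (m ⟨⟩)).1 hm, hf ⟨⟩⟩
  diagonalization := fun A B A' B' e m f g he hm hfg => by
    simpa using h.diagonalization e ⟨A', PUnit, fun _ => B', fun _ => m⟩ f (fun _ => g) he
      ((isMono_single_iff m).2 hm) fun _ => hfg

theorem IsExtremalMono.of_isRegularMono {A B : C} (m : A ⟶ B)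
    [IsRegularMono m] : IsExtremalMono m := by
  refine ⟨inferInstance, fun Z e g he heg => ?_⟩
  have : StrongMono (e ≫ g) := heg ▸ inferInstance
  have : StrongMono e := strongMono_of_strongMono e g
  exact isIso_of_epi_of_strongMono e

theorem extremalEpi_of_isRegularEpi {A B : C} (e : A ⟶ B)
    [IsRegularEpi e] : ExtremalEpi e := by
  have : Epi e := (IsRegularEpi.getStruct e).epi
  refine ⟨fun p i fac _ => ?_⟩
  have : StrongEpi (p ≫ i) := fac ▸ inferInstance
  have : StrongEpi i := strongEpi_of_strongEpi p i
  exact isIso_of_mono_of_strongEpi i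

end Sources

section Structured

variable {X : Type u'} [Category.{v'} X] (S : X ⥤ JCPos.{u})

/-! ### Initial and final structures -/

variable {S} in
theorem Structured.hom_ext {A B : Structured S} {f g : A ⟶ B} (h : f.base = g.base) : f = g :=
  Structured.Hom.ext h

theorem push_mono {A B : X} (f : A ⟶ B) {x y : S.obj A} (h : x ≤ y) : push S f x ≤ push S f y :=
  OrderHomClass.mono (push S f) h

theorem push_bot_le {A B : X} (f : A ⟶ B) (y : S.obj B) : push S f ⊥ ≤ y := by
  rw [map_bot]
  exact bot_le

theorem push_iSup {A B : X} (f : A ⟶ B) {ι : Type w} (x : ι → S.obj A) :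
    push S f (⨆ i, x i) = ⨆ i, push S f (x i) := by
  rw [← sSup_range, map_sSup, ← Set.range_comp, sSup_range]
  rfl

theorem push_le_of_fac {A B C : X} {f : A ⟶ B} {g : B ⟶ C} {k : A ⟶ C} (h : f ≫ g = k)
    {x : S.obj A} {y : S.obj C} (hk : push S k x ≤ y) : push S g (push S f x) ≤ y := by
  rwa [← push_comp, h]

theorem isInitial_iff_forall (s : Source.{w} (Structured S)) :
    s.IsInitial (forg S) ↔ ∀ (B : Structured S) (g : B.base ⟶ s.dom.base),
      (∀ i, push S (g ≫ (s.hom i).base) B.str ≤ (s.cod i).str) → push S g B.str ≤ s.dom.str :=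
  ⟨fun h B g hg => by
    obtain ⟨k, rfl⟩ := @h B g fun i => ⟨⟨_, hg i⟩, rfl⟩
    exact k.push_le,
  fun h B g hg => ⟨⟨g, h B g fun i => by
    obtain ⟨k, hk⟩ := hg i
    exact hk ▸ k.push_le⟩, rfl⟩⟩

theorem isFinal_iff_forall (s : Sink.{w} (Structured S)) :
    s.IsFinal (forg S) ↔ ∀ (B : Structured S) (g : s.cod.base ⟶ B.base),
      (∀ i, push S ((s.hom i).base ≫ g) (s.dom i).str ≤ B.str) → push S g s.cod.str ≤ B.str :=
  ⟨fun h B g hg => by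
    obtain ⟨k, rfl⟩ := @h B g fun i => ⟨⟨_, hg i⟩, rfl⟩
    exact k.push_le,
  fun h B g hg => ⟨⟨g, h B g fun i => by
    obtain ⟨k, hk⟩ := hg i
    exact hk ▸ k.push_le⟩, rfl⟩⟩

/-- A source is initial if and only if its domain carries the coarsest structure which turns the
underlying maps into morphisms. (The reverse inequality always holds.) -/
theorem isInitial_iff (s : Source.{w} (Structured S)) :
    s.IsInitial (forg S) ↔ ⨅ i, pull S (s.hom i).base (s.cod i).str ≤ s.dom.str := by
  rw [isInitial_iff_forall]
  constructor
  · intro h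
    have := h ⟨s.dom.base, ⨅ i, pull S (s.hom i).base (s.cod i).str⟩ (𝟙 s.dom.base) fun i => by
      rw [Category.id_comp]
      exact (le_pull_iff S _ _ _).1 (iInf_le _ i)
    exact (push_id S _ _).ge.trans this
  · intro h B g hg
    exact le_trans (le_iInf fun i => (le_pull_iff S _ _ _).2 (push_le_of_fac S rfl (hg i))) h

/-- A sink is final if and only if its codomain carries the finest structure which turns the
underlying maps into morphisms. (The reverse inequality always holds.) -/
theorem isFinal_iff (s : Sink.{w} (Structured S)) :
    s.IsFinal (forg S) ↔ s.cod.str ≤ ⨆ i, push S (s.hom i).base (s.dom i).str := by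
  rw [isFinal_iff_forall]
  constructor
  · intro h
    have := h ⟨s.cod.base, ⨆ i, push S (s.hom i).base (s.dom i).str⟩ (𝟙 s.cod.base) fun i => by
      rw [Category.comp_id]
      exact le_iSup (fun i => push S (s.hom i).base (s.dom i).str) i
    exact (push_id S _ _).ge.trans this
  · intro h B g hg
    refine (push_mono S g h).trans ?_
    rw [push_iSup]
    exact iSup_le fun i => push_le_of_fac S rfl (hg i)

theorem isEmbedding_iff {A B : Structured S} (m : A ⟶ B) :
    IsEmbedding (forg S) m ↔ Mono m ∧ pull S m.base B.str ≤ A.str := by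
  rw [IsEmbedding, isInitial_iff]
  exact and_congr_right' (iff_of_eq (congrArg (· ≤ A.str)
    (iInf_const : ⨅ _ : Unit, pull S m.base B.str = _)))

theorem isQuotient_iff {A B : Structured S} (e : A ⟶ B) :
    IsQuotient (forg S) e ↔ Epi e ∧ B.str ≤ push S e.base A.str := by
  rw [IsQuotient, isFinal_iff]
  exact and_congr_right' (iff_of_eq (congrArg (B.str ≤ ·)
    (iSup_const : ⨆ _ : Unit, push S e.base A.str = _)))

/-- An isomorphism of underlying objects transports structures. -/
def isoOfBase (A : Structured S) {Y : X} (i : A.base ≅ Y) :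
    A ≅ (⟨Y, push S i.hom A.str⟩ : Structured S) where
  hom := ⟨i.hom, le_rfl⟩
  inv := ⟨i.inv, by rw [← push_comp, i.hom_inv_id, push_id]⟩
  hom_inv_id := Structured.hom_ext i.hom_inv_id
  inv_hom_id := Structured.hom_ext i.inv_hom_id

/-- The fibres of the forgetful functor are posets: an isomorphism over an identity forces the two
structures to agree. -/
theorem le_of_isIso_of_base_eq_id {Y : X} {x y : S.obj Y}
    (e : (⟨Y, x⟩ : Structured S) ⟶ ⟨Y, y⟩) [IsIso e] (he : e.base = 𝟙 Y) : y ≤ x := by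
  have hinv : (inv e).base ≫ e.base = 𝟙 Y := congrArg Structured.Hom.base (IsIso.inv_hom_id e)
  rw [he, Category.comp_id] at hinv
  have := (inv e).push_le
  rw [hinv] at this
  exact (push_id S _ _).ge.trans this

/-! ### Adjoints of the forgetful functor -/

/-- The discrete functor is left adjoint to the forgetful functor. -/
def discreteAdj : discrete S ⊣ forg S :=
  Adjunction.mkOfHomEquiv
    { homEquiv := fun _ _ =>
        { toFun := fun f => f.base
          invFun := fun f => ⟨f, push_bot_le S f _⟩
          left_inv := fun _ => rfl
          right_inv := fun _ => rfl }
      homEquiv_naturality_left_symm := fun _ _ => rfl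
      homEquiv_naturality_right := fun _ _ => rfl }

/-- The indiscrete functor is right adjoint to the forgetful functor. -/
def indiscreteAdj : forg S ⊣ indiscrete S :=
  Adjunction.mkOfHomEquiv
    { homEquiv := fun _ _ =>
        { toFun := fun f => ⟨f, le_top⟩
          invFun := fun f => f.base
          left_inv := fun _ => rfl
          right_inv := fun _ => rfl }
      homEquiv_naturality_left_symm := fun _ _ => rfl
      homEquiv_naturality_right := fun _ _ => rfl }

theorem forg_preservesLimits : PreservesLimitsOfSize.{v, w} (forg S) :=
  (discreteAdj S).rightAdjoint_preservesLimits

theorem forg_preservesColimits : PreservesColimitsOfSize.{v, w} (forg S) :=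
  (indiscreteAdj S).leftAdjoint_preservesColimits

theorem mono_iff_mono_base {A B : Structured S} (f : A ⟶ B) : Mono f ↔ Mono f.base := by
  have := (discreteAdj S).isRightAdjoint
  exact ⟨fun _ => inferInstanceAs (Mono ((forg S).map f)),
    fun h => (forg S).mono_of_mono_map (f := f) h⟩

theorem epi_iff_epi_base {A B : Structured S} (f : A ⟶ B) : Epi f ↔ Epi f.base := by
  have := (indiscreteAdj S).isLeftAdjoint
  exact ⟨fun _ => inferInstanceAs (Epi ((forg S).map f)),
    fun h => (forg S).epi_of_epi_map (f := f) h⟩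

/-- The underlying source of a source of structured objects. -/
def Source.base (s : Source.{w} (Structured S)) : Source.{w} X :=
  ⟨s.dom.base, s.ι, fun i => (s.cod i).base, fun i => (s.hom i).base⟩

theorem isMono_iff_isMono_base (s : Source.{w} (Structured S)) :
    s.IsMono ↔ (s.base S).IsMono := by
  constructor
  · intro h B p q hpq
    -- Parallel maps in the base are tested on the discrete structure of their domain.
    exact congrArg Structured.Hom.base
      (@h ⟨B, ⊥⟩ ⟨p, push_bot_le S p _⟩ ⟨q, push_bot_le S q _⟩ fun i => Structured.hom_ext (hpq i))
  · intro h B p q hpq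
    exact Structured.hom_ext (h _ _ fun i => congrArg Structured.Hom.base (hpq i))

theorem hasSeparator_structured [HasSeparator X] : HasSeparator (Structured S) := by
  refine ⟨⟨(discrete S).obj (separator X), (isSeparator_def _).2 fun A B f g h => ?_⟩⟩
  refine Structured.hom_ext ((isSeparator_def _).1 (isSeparator_separator X) _ _ fun k => ?_)
  exact congrArg Structured.Hom.base (h (⟨k, push_bot_le S k _⟩ : (discrete S).obj (separator X) ⟶ A))

theorem hasCoseparator_structured [HasCoseparator X] : HasCoseparator (Structured S) := by
  refine ⟨⟨(indiscrete S).obj (coseparator X), (isCoseparator_def _).2 fun A B f g h => ?_⟩⟩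
  refine Structured.hom_ext ((isCoseparator_def _).1 (isCoseparator_coseparator X) _ _ fun k => ?_)
  exact congrArg Structured.Hom.base (h (⟨k, le_top⟩ : B ⟶ (indiscrete S).obj (coseparator X)))

/-! ### Limits and colimits -/

section Limits

variable {J : Type w} [Category.{v} J] (D : J ⥤ Structured S)

theorem initialLift_isInitial (l : Cone (D ⋙ forg S)) :
    (Source.ofCone (initialLift S D l)).IsInitial (forg S) :=
  (isInitial_iff S _).2 le_rfl

theorem finalLift_isFinal (c : Cocone (D ⋙ forg S)) :
    (Sink.ofCocone (finalLift S D c)).IsFinal (forg S) :=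
  (isFinal_iff S _).2 le_rfl

variable {D}

/-- The initial lift of a limit cone is a limit cone. -/
def isLimitInitialLift {l : Cone (D ⋙ forg S)} (hl : IsLimit l) :
    IsLimit (initialLift S D l) where
  lift s := ⟨hl.lift ((forg S).mapCone s), le_iInf fun i => (le_pull_iff S (l.π.app i) _ _).2 <|
    push_le_of_fac S (hl.fac ((forg S).mapCone s) i) (s.π.app i).push_le⟩
  fac s i := Structured.hom_ext (hl.fac ((forg S).mapCone s) i)
  uniq s m hm := Structured.hom_ext (hl.uniq ((forg S).mapCone s) m.base fun i =>
    congrArg Structured.Hom.base (hm i))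

/-- The final lift of a colimit cocone is a colimit cocone. -/
def isColimitFinalLift {c : Cocone (D ⋙ forg S)} (hc : IsColimit c) :
    IsColimit (finalLift S D c) where
  desc s := ⟨hc.desc ((forg S).mapCocone s), by
    refine (push_iSup S _ fun i => push S (c.ι.app i) (D.obj i).str).le.trans ?_
    exact iSup_le fun i =>
      push_le_of_fac S (hc.fac ((forg S).mapCocone s) i) (s.ι.app i).push_le⟩
  fac s i := Structured.hom_ext (hc.fac ((forg S).mapCocone s) i)
  uniq s m hm := Structured.hom_ext (hc.uniq ((forg S).mapCocone s) m.base fun i =>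
    congrArg Structured.Hom.base (hm i))

theorem nonempty_isLimit_mapCone {L : Cone D} (hL : IsLimit L) :
    Nonempty (IsLimit ((forg S).mapCone L)) :=
  have := forg_preservesLimits.{w, v', u', v, u} S
  ⟨isLimitOfPreserves (forg S) hL⟩

theorem nonempty_isColimit_mapCocone {K : Cocone D} (hK : IsColimit K) :
    Nonempty (IsColimit ((forg S).mapCocone K)) :=
  have := forg_preservesColimits.{w, v', u', v, u} S
  ⟨isColimitOfPreserves (forg S) hK⟩

theorem str_eq_of_isLimit {L : Cone D} (hL : IsLimit L) :
    L.pt.str = ⨅ i, (assoc S).map (L.π.app i).base.op (D.obj i).str := by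
  obtain ⟨hUL⟩ := nonempty_isLimit_mapCone S hL
  apply le_antisymm
  · exact le_iInf fun i => (le_pull_iff S (L.π.app i).base _ _).2 (L.π.app i).push_le
  · -- The comparison from the initial lift into the limit lies over the identity.
    let k := hL.lift (initialLift S D ((forg S).mapCone L))
    have hk : k.base = 𝟙 L.pt.base := hUL.hom_ext fun i =>
      (congrArg Structured.Hom.base (hL.fac (initialLift S D ((forg S).mapCone L)) i)).trans
        (Category.id_comp _).symm
    have := k.push_le
    rw [hk] at this
    exact (push_id S _ _).symm.le.trans this

theorem str_eq_of_isColimit {K : Cocone D} (hK : IsColimit K) :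
    K.pt.str = ⨆ i, S.map (K.ι.app i).base (D.obj i).str := by
  obtain ⟨hUK⟩ := nonempty_isColimit_mapCocone S hK
  apply le_antisymm
  · -- Dually, the comparison out of the colimit lies over the identity.
    let k := hK.desc (finalLift S D ((forg S).mapCocone K))
    have hk : k.base = 𝟙 K.pt.base := hUK.hom_ext fun i =>
      (congrArg Structured.Hom.base (hK.fac (finalLift S D ((forg S).mapCocone K)) i)).trans
        (Category.comp_id _).symm
    have := k.push_le
    rw [hk] at this
    exact (push_id S _ _).symm.le.trans this
  · exact iSup_le fun i => (K.ι.app i).push_le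

variable (J)

theorem hasLimitsOfShape_structured [HasLimitsOfShape J X] :
    HasLimitsOfShape J (Structured S) :=
  ⟨fun D => ⟨⟨⟨_, isLimitInitialLift S (limit.isLimit (D ⋙ forg S))⟩⟩⟩⟩

theorem hasColimitsOfShape_structured [HasColimitsOfShape J X] :
    HasColimitsOfShape J (Structured S) :=
  ⟨fun D => ⟨⟨⟨_, isColimitFinalLift S (colimit.isColimit (D ⋙ forg S))⟩⟩⟩⟩

end Limits

/-! ### Wellpoweredness -/

section WellPowered

variable {X : Type u'} [Category.{u} X] (S : X ⥤ JCPos.{u})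

/-- A subobject of `A` is given by a subobject of the underlying object together with one of the
set-many structures on it. -/
theorem wellPowered_structured [WellPowered.{u} X] : WellPowered.{u} (Structured S) where
  subobject_small A := by
    let T := Σ P : Subobject A.base, {x : S.obj (P : X) // push S P.arrow x ≤ A.str}
    let arrow (t : T) : (⟨t.1, t.2.1⟩ : Structured S) ⟶ A := ⟨t.1.arrow, t.2.2⟩
    have hmono (t : T) : Mono (arrow t) :=
      (mono_iff_mono_base S _).2 (inferInstanceAs (Mono t.1.arrow))
    refine small_of_surjective (f := fun t : T => Subobject.mk (arrow t)) fun Q => ?_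
    induction Q using Subobject.ind with
    | @h B f _ =>
      have := (mono_iff_mono_base S f).1 inferInstance
      let i := (Subobject.underlyingIso f.base).symm
      have hi : i.hom ≫ (Subobject.mk f.base).arrow = f.base := Subobject.underlyingIso_arrow _
      let t : T := ⟨Subobject.mk f.base, push S i.hom B.str, push_le_of_fac S hi f.push_le⟩
      exact ⟨t, (Subobject.mk_eq_mk_of_comm f (arrow t) (isoOfBase S _ i)
        (Structured.hom_ext hi)).symm⟩

/-- A quotient object of `A` is given by a quotient object of the underlying object together with
one of the set-many structures on it. -/
theorem wellPowered_structured_op [WellPowered.{u} Xᵒᵖ] : WellPowered.{u} (Structured S)ᵒᵖ where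
  subobject_small A := by
    let T := Σ P : Subobject (Opposite.op A.unop.base),
      {x : S.obj (P : Xᵒᵖ).unop // push S P.arrow.unop A.unop.str ≤ x}
    let arrow (t : T) : Opposite.op (⟨(t.1 : Xᵒᵖ).unop, t.2.1⟩ : Structured S) ⟶ A :=
      Quiver.Hom.op ⟨t.1.arrow.unop, t.2.2⟩
    have hmono (t : T) : Mono (arrow t) := by
      have : Epi (arrow t).unop :=
        (epi_iff_epi_base S _).2 (inferInstanceAs (Epi t.1.arrow.unop))
      exact op_mono_of_epi (arrow t).unop
    refine small_of_surjective (f := fun t : T => Subobject.mk (arrow t)) fun Q => ?_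
    induction Q using Subobject.ind with
    | @h B f _ =>
      have : Epi f.unop.base := (epi_iff_epi_base S f.unop).1 inferInstance
      have : Mono f.unop.base.op := inferInstance
      let i := (Subobject.underlyingIso f.unop.base.op).unop
      have hi : f.unop.base ≫ i.hom = (Subobject.mk f.unop.base.op).arrow.unop :=
        congrArg Quiver.Hom.unop (Subobject.underlyingIso_hom_comp_eq_mk f.unop.base.op)
      let t : T := ⟨Subobject.mk f.unop.base.op, push S i.hom B.unop.str, by
        rw [← hi, push_comp]
        exact push_mono S _ f.unop.push_le⟩
      exact ⟨t, Subobject.mk_eq_mk_of_comm (arrow t) f (isoOfBase S B.unop i).op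
        (congrArg Quiver.Hom.op (Structured.hom_ext hi))⟩

end WellPowered

/-! ### Embeddings and quotient morphisms -/

theorem IsExtremalMono.isEmbedding {A B : Structured S} {f : A ⟶ B} (hf : IsExtremalMono f) :
    IsEmbedding (forg S) f := by
  refine (isEmbedding_iff S f).2 ⟨hf.1, ?_⟩
  -- The identity, into the coarsest structure for which `f` is a morphism, is an epimorphism.
  let Z : Structured S := ⟨A.base, pull S f.base B.str⟩
  let e : A ⟶ Z := ⟨𝟙 A.base, by
    rw [push_id]
    exact (le_pull_iff S _ _ _).2 f.push_le⟩
  let g : Z ⟶ B := ⟨f.base, (le_pull_iff S _ _ _).1 le_rfl⟩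
  have : IsIso e := hf.2 e g ((epi_iff_epi_base S e).2 (inferInstanceAs (Epi (𝟙 A.base))))
    (Structured.hom_ext (Category.id_comp f.base))
  exact le_of_isIso_of_base_eq_id S e rfl

theorem isQuotient_of_extremalEpi {A B : Structured S} (f : A ⟶ B) [ExtremalEpi f] :
    IsQuotient (forg S) f := by
  refine (isQuotient_iff S f).2 ⟨inferInstance, ?_⟩
  -- The identity, out of the finest structure for which `f` is a morphism, is a monomorphism.
  let Z : Structured S := ⟨B.base, push S f.base A.str⟩
  let p : A ⟶ Z := ⟨f.base, le_rfl⟩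
  let i : Z ⟶ B := ⟨𝟙 B.base, (push_id S _ _).trans_le f.push_le⟩
  have : Mono i := (mono_iff_mono_base S i).2 (inferInstanceAs (Mono (𝟙 B.base)))
  have : IsIso i := ExtremalEpi.isIso f p i (Structured.hom_ext (Category.comp_id f.base))
  exact le_of_isIso_of_base_eq_id S i rfl

/-- If `f.base` is the equalizer of a pair, then an embedding `f` is the equalizer of that pair
with indiscrete codomain. -/
theorem IsEmbedding.isRegularMono [IsRegularMonoCategory X] {A B : Structured S} {f : A ⟶ B}
    (hf : IsEmbedding (forg S) f) : IsRegularMono f := by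
  obtain ⟨hm, hi⟩ := (isEmbedding_iff S f).1 hf
  have := (mono_iff_mono_base S f).1 hm
  let r : RegularMono f.base := regularMonoOfMono f.base
  let left : B ⟶ (indiscrete S).obj r.Z := ⟨r.left, le_top⟩
  let right : B ⟶ (indiscrete S).obj r.Z := ⟨r.right, le_top⟩
  have w : f ≫ left = f ≫ right := Structured.hom_ext r.w
  refine ⟨⟨⟨_, left, right, w, Fork.IsLimit.mk' _ fun s => ?_⟩⟩⟩
  have hs : s.ι.base ≫ r.left = s.ι.base ≫ r.right := congrArg Structured.Hom.base s.condition
  obtain ⟨l, hl⟩ := Fork.IsLimit.lift' r.isLimit s.ι.base hs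
  exact ⟨⟨l, ((le_pull_iff S _ _ _).2 (push_le_of_fac S hl s.ι.push_le)).trans hi⟩,
    Structured.hom_ext hl, fun {_} hm => (cancel_mono f).1 (hm.trans (Structured.hom_ext hl.symm))⟩

/-- If `f.base` is the coequalizer of a pair, then a quotient morphism `f` is the coequalizer of
that pair with discrete domain. -/
theorem IsQuotient.isRegularEpi [IsRegularEpiCategory X] {A B : Structured S} {f : A ⟶ B}
    (hf : IsQuotient (forg S) f) : IsRegularEpi f := by
  obtain ⟨he, hi⟩ := (isQuotient_iff S f).1 hf
  have := (epi_iff_epi_base S f).1 he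
  let r : RegularEpi f.base := regularEpiOfEpi f.base
  let left : (discrete S).obj r.W ⟶ A := ⟨r.left, push_bot_le S _ _⟩
  let right : (discrete S).obj r.W ⟶ A := ⟨r.right, push_bot_le S _ _⟩
  have w : left ≫ f = right ≫ f := Structured.hom_ext r.w
  refine ⟨⟨⟨_, left, right, w, Cofork.IsColimit.mk' _ fun s => ?_⟩⟩⟩
  have hs : r.left ≫ s.π.base = r.right ≫ s.π.base := congrArg Structured.Hom.base s.condition
  obtain ⟨l, hl⟩ := Cofork.IsColimit.desc' r.isColimit s.π.base hs
  exact ⟨⟨l, (push_mono S l hi).trans (push_le_of_fac S hl s.π.push_le)⟩,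
    Structured.hom_ext hl, fun {_} hm => (cancel_epi f).1 (hm.trans (Structured.hom_ext hl.symm))⟩

theorem isEmbedding_iff_isExtremalMono_iff_isRegularMono [IsRegularMonoCategory X]
    {A B : Structured S} (f : A ⟶ B) :
    (IsEmbedding (forg S) f ↔ IsExtremalMono f) ∧ (IsExtremalMono f ↔ IsRegularMono f) :=
  ⟨⟨fun h => have := h.isRegularMono; .of_isRegularMono f, fun h => h.isEmbedding⟩,
    ⟨fun h => h.isEmbedding.isRegularMono, fun _ => .of_isRegularMono f⟩⟩

theorem isQuotient_iff_extremalEpi_iff_isRegularEpi [IsRegularEpiCategory X]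
    {A B : Structured S} (f : A ⟶ B) :
    (IsQuotient (forg S) f ↔ ExtremalEpi f) ∧ (ExtremalEpi f ↔ IsRegularEpi f) :=
  ⟨⟨fun h => have := h.isRegularEpi; extremalEpi_of_isRegularEpi f,
      fun _ => isQuotient_of_extremalEpi S f⟩,
    ⟨fun _ => (isQuotient_of_extremalEpi S f).isRegularEpi,
      fun _ => extremalEpi_of_isRegularEpi f⟩⟩

/-! ### Factorizations of sources -/

section Factorization

variable (X) in
/-- Every source factors as an epimorphism followed by a mono-source. -/
def HasEpiMonoSourceFactorizations : Prop :=
  ∀ s : Source.{w} X, ∃ (B : X) (e : s.dom ⟶ B) (m : ∀ i, B ⟶ s.cod i),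
    Epi e ∧ Source.IsMono ⟨B, s.ι, s.cod, m⟩ ∧ ∀ i, e ≫ m i = s.hom i

/-- The forward direction tests extremality on the identity into the initial structure; conversely,
a diagonal in the base provides the inverse of an epimorphism which is factored out. -/
theorem isExtremalMono_iff [IsRegularEpiCategory X] (s : Source.{w} (Structured S)) :
    s.IsExtremalMono ↔ s.IsMono ∧ s.IsInitial (forg S) := by
  constructor
  · rintro ⟨hm, he⟩
    refine ⟨hm, (isInitial_iff S s).2 ?_⟩
    let Z : Structured S := ⟨s.dom.base, ⨅ i, pull S (s.hom i).base (s.cod i).str⟩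
    let e : s.dom ⟶ Z := ⟨𝟙 s.dom.base, by
      rw [push_id]
      exact le_iInf fun i => (le_pull_iff S _ _ _).2 (s.hom i).push_le⟩
    have : IsIso e := he e (fun i => ⟨(s.hom i).base, (le_pull_iff S _ _ _).1 (iInf_le _ i)⟩)
      ((epi_iff_epi_base S e).2 (inferInstanceAs (Epi (𝟙 s.dom.base))))
      fun i => Structured.hom_ext (Category.id_comp _)
    exact le_of_isIso_of_base_eq_id S e rfl
  · rintro ⟨hm, hi⟩
    refine ⟨hm, fun B e g he heg => ?_⟩
    have heb : Epi e.base := (epi_iff_epi_base S e).1 he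
    have := IsRegularEpiCategory.regularEpiOfEpi e.base
    -- The inverse of `e` is the diagonal of the square with sides `e`, `𝟙`, `g` and the source.
    obtain ⟨d, ⟨hd, hdg⟩, -⟩ := ((isMono_iff_isMono_base S s).1 hm).existsUnique_diagonal e.base
      (𝟙 s.dom.base) (fun i => (g i).base) fun i =>
        (congrArg Structured.Hom.base (heg i)).trans (Category.id_comp _).symm
    let d' : B ⟶ s.dom := ⟨d, (isInitial_iff_forall S s).1 hi B d fun i =>
      (congrArg (fun k => push S k B.str) (hdg i)).le.trans (g i).push_le⟩
    have h : e ≫ d' = 𝟙 s.dom := Structured.hom_ext hd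
    refine ⟨d', h, ?_⟩
    rw [← cancel_epi e, reassoc_of% h, Category.comp_id]

theorem isEMCategory_epimorphisms_isExtremalMono [IsRegularEpiCategory X]
    (hX : HasEpiMonoSourceFactorizations.{w} X) :
    IsEMCategory.{w} (MorphismProperty.epimorphisms (Structured S)) Source.IsExtremalMono where
  comp_iso _ _ _ e h he _ :=
    have : Epi e := he
    MorphismProperty.epimorphisms.infer_property (e ≫ h)
  iso_comp _ _ h hs _ := hs.precomp h
  factorization s := by
    obtain ⟨B, e, m, he, hm, hf⟩ := hX (s.base S)
    -- The intermediate object carries the initial structure.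
    let Z : Structured S := ⟨B, ⨅ i, pull S (m i) (s.cod i).str⟩
    let e' : s.dom ⟶ Z := ⟨e, le_iInf fun i => (le_pull_iff S _ _ _).2
      (push_le_of_fac S (hf i) (s.hom i).push_le)⟩
    let m' (i) : Z ⟶ s.cod i := ⟨m i, (le_pull_iff S _ _ _).1 (iInf_le _ i)⟩
    exact ⟨Z, e', m', (epi_iff_epi_base S e').2 he,
      (isExtremalMono_iff S _).2 ⟨(isMono_iff_isMono_base S ⟨Z, s.ι, s.cod, m'⟩).2 hm,
        (isInitial_iff S ⟨Z, s.ι, s.cod, m'⟩).2 le_rfl⟩,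
      fun i => Structured.hom_ext (hf i)⟩
  diagonalization A B e m f g he hm hfg := by
    obtain ⟨hm, hi⟩ := (isExtremalMono_iff S m).1 hm
    have heb : Epi e.base := (epi_iff_epi_base S e).1 he
    have := IsRegularEpiCategory.regularEpiOfEpi e.base
    obtain ⟨d, ⟨hd, hdg⟩, hu⟩ := ((isMono_iff_isMono_base S m).1 hm).existsUnique_diagonal e.base
      f.base (fun i => (g i).base) fun i => congrArg Structured.Hom.base (hfg i)
    refine ⟨⟨d, (isInitial_iff_forall S m).1 hi B d fun i =>
      (congrArg (fun k => push S k B.str) (hdg i)).le.trans (g i).push_le⟩,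
      ⟨Structured.hom_ext hd, fun i => Structured.hom_ext (hdg i)⟩, fun d' hd' => ?_⟩
    exact Structured.hom_ext (hu d'.base ⟨congrArg Structured.Hom.base hd'.1,
      fun i => congrArg Structured.Hom.base (hd'.2 i)⟩)

theorem isEMCategory_regularEpi_isMono [IsRegularEpiCategory X]
    (hX : HasEpiMonoSourceFactorizations.{w} X) :
    IsEMCategory.{w} (MorphismProperty.regularEpi (Structured S)) Source.IsMono where
  comp_iso _ _ _ e h he _ := MorphismProperty.RespectsIso.postcomp _ h e he
  iso_comp _ _ h hs _ := hs.precomp h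
  factorization s := by
    obtain ⟨B, e, m, he, hm, hf⟩ := hX (s.base S)
    -- The intermediate object carries the final structure.
    let Z : Structured S := ⟨B, push S e s.dom.str⟩
    let e' : s.dom ⟶ Z := ⟨e, le_rfl⟩
    let m' (i) : Z ⟶ s.cod i := ⟨m i, push_le_of_fac S (hf i) (s.hom i).push_le⟩
    exact ⟨Z, e', m',
      ((isQuotient_iff S e').2 ⟨(epi_iff_epi_base S e').2 he, le_rfl⟩).isRegularEpi,
      (isMono_iff_isMono_base S ⟨Z, s.ι, s.cod, m'⟩).2 hm, fun i => Structured.hom_ext (hf i)⟩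
  diagonalization A B e m f g he hm hfg :=
    have : IsRegularEpi e := he
    hm.existsUnique_diagonal e f g hfg

end Factorization

end Structured

/-! ### Categories of sets -/

section SetLike

variable {X : Type u'} [Category.{v'} X]

/-- A full subcategory of the category of sets, given by its inclusion functor, which is closed
under quotients and contains a two-element set. -/
structure IsSetLike (F : X ⥤ Type u) : Prop where
  full : F.Full
  faithful : F.Faithful
  exists_quotient (A : X) (r : Setoid (F.obj A)) : ∃ B, Nonempty (F.obj B ≃ Quotient r)
  exists_two : ∃ T, Nonempty (F.obj T ≃ ULift.{u} Bool)

namespace IsSetLike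

variable {F : X ⥤ Type u}

theorem exists_map_eq (hF : IsSetLike F) {A B : X} (f : F.obj A → F.obj B) :
    ∃ g : A ⟶ B, ∀ x, F.map g x = f x := by
  have := hF.full
  obtain ⟨g, hg⟩ := F.map_surjective (TypeCat.ofHom f)
  exact ⟨g, fun x => by rw [hg]; rfl⟩

theorem hom_ext (hF : IsSetLike F) {A B : X} {f g : A ⟶ B} (h : ∀ x, F.map f x = F.map g x) :
    f = g := by
  have := hF.faithful
  refine F.map_injective ?_
  ext x
  exact h x

theorem exists_punit (hF : IsSetLike F) : ∃ T, Nonempty (F.obj T ≃ PUnit.{u + 1}) := by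
  obtain ⟨T, ⟨ε⟩⟩ := hF.exists_two
  obtain ⟨P, ⟨δ⟩⟩ := hF.exists_quotient T ⊤
  have : Subsingleton (Quotient (⊤ : Setoid (F.obj T))) :=
    ⟨by rintro ⟨x⟩ ⟨y⟩; exact Quotient.sound trivial⟩
  have : Unique (Quotient (⊤ : Setoid (F.obj T))) :=
    uniqueOfSubsingleton (Quotient.mk _ (ε.symm ⟨true⟩))
  exact ⟨P, ⟨δ.trans (Equiv.ofUnique _ _)⟩⟩

/-- The characteristic maps of subsets. -/
theorem exists_classifier (hF : IsSetLike F) : ∃ (T : X) (t : F.obj T), ∀ (A : X)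
    (s : Set (F.obj A)), ∃ c : A ⟶ T, ∀ x, F.map c x = t ↔ x ∈ s := by
  classical
  obtain ⟨T, ⟨ε⟩⟩ := hF.exists_two
  refine ⟨T, ε.symm ⟨true⟩, fun A s => ?_⟩
  obtain ⟨c, hc⟩ := hF.exists_map_eq fun x : F.obj A => ε.symm ⟨decide (x ∈ s)⟩
  exact ⟨c, fun x => by simp [hc]⟩

theorem surjective_of_epi (hF : IsSetLike F) {A B : X} (f : A ⟶ B) [Epi f] :
    Function.Surjective (F.map f) := by
  obtain ⟨T, t, hT⟩ := hF.exists_classifier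
  obtain ⟨c, hc⟩ := hT B (Set.range (F.map f))
  obtain ⟨d, hd⟩ := hT B Set.univ
  have : c = d := by
    rw [← cancel_epi f]
    refine hF.hom_ext fun x => ?_
    simp only [Functor.map_comp, types_comp_apply]
    rw [(hc _).2 ⟨x, rfl⟩, (hd _).2 trivial]
  intro y
  rw [← Set.mem_range, ← hc, this, hd]
  trivial

theorem hasSeparator (hF : IsSetLike F) : HasSeparator X := by
  obtain ⟨P, ⟨δ⟩⟩ := hF.exists_punit
  refine ⟨⟨P, (isSeparator_def _).2 fun A B f g h => hF.hom_ext fun x => ?_⟩⟩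
  obtain ⟨p, hp⟩ := hF.exists_map_eq fun _ : F.obj P => x
  have := congrArg (fun k => F.map k (δ.symm ⟨⟩)) (h p)
  simpa [hp] using this

theorem hasCoseparator (hF : IsSetLike F) : HasCoseparator X := by
  obtain ⟨T, t, hT⟩ := hF.exists_classifier
  refine ⟨⟨T, (isCoseparator_def _).2 fun A B f g h => hF.hom_ext fun x => ?_⟩⟩
  obtain ⟨c, hc⟩ := hT B {F.map g x}
  have := congrArg (fun k => F.map k x) (h c)
  simp only [Functor.map_comp, types_comp_apply] at this
  rw [(hc (F.map g x)).2 rfl] at this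
  exact (hc _).1 this

/-- A monomorphism is the equalizer of the characteristic maps of its image and of its whole
codomain. -/
theorem isRegularMonoCategory (hF : IsSetLike F) : IsRegularMonoCategory X where
  regularMonoOfMono {A B} f _ := by
    obtain ⟨T, t, hT⟩ := hF.exists_classifier
    obtain ⟨c, hc⟩ := hT B (Set.range (F.map f))
    obtain ⟨d, hd⟩ := hT B Set.univ
    have w : f ≫ c = f ≫ d := hF.hom_ext fun x => by
      simp only [Functor.map_comp, types_comp_apply]
      rw [(hc _).2 ⟨x, rfl⟩, (hd _).2 trivial]
    refine ⟨⟨⟨T, c, d, w, Fork.IsLimit.mk' _ fun s => ?_⟩⟩⟩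
    have hs (z) : F.map s.ι z ∈ Set.range (F.map f) := by
      have := congrArg (fun k => F.map k z) s.condition
      simp only [Functor.map_comp, types_comp_apply] at this
      rw [← hc, this, hd]
      trivial
    choose l hl using hs
    choose l' hl' using hF.exists_map_eq l
    have hfac : l' ≫ f = s.ι := hF.hom_ext fun z => by simp [hl', hl]
    exact ⟨l', hfac, fun {_} hm => (cancel_mono f).1 (hm.trans hfac.symm)⟩

/-- A surjection is the coequalizer of its kernel pair. -/
theorem isRegularEpiCategory (hF : IsSetLike F) [HasPullbacks X] : IsRegularEpiCategory X where
  regularEpiOfEpi {A B} f _ := by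
    refine IsRegularEpi.of_epi_of_exists fun Z g hg => ?_
    obtain ⟨P, ⟨δ⟩⟩ := hF.exists_punit
    have hfg (x y : F.obj A) (hxy : F.map f x = F.map f y) : F.map g x = F.map g y := by
      obtain ⟨p, hp⟩ := hF.exists_map_eq fun _ : F.obj P => x
      obtain ⟨q, hq⟩ := hF.exists_map_eq fun _ : F.obj P => y
      have hpq : p ≫ f = q ≫ f := hF.hom_ext fun z => by simp [hp, hq, hxy]
      have hpq' : p ≫ g = q ≫ g := by
        rw [← pullback.lift_fst p q hpq, Category.assoc, hg, pullback.lift_snd_assoc]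
      simpa [hp, hq] using congrArg (fun k => F.map k (δ.symm ⟨⟩)) hpq'
    choose σ hσ using hF.surjective_of_epi f
    obtain ⟨u, hu⟩ := hF.exists_map_eq fun y => F.map g (σ y)
    exact ⟨u, hF.hom_ext fun x => by simpa [hu] using hfg _ _ (hσ _)⟩

/-- A source factors through the quotient of its domain by the relation of having the same image
under each map of the source. -/
theorem hasEpiMonoSourceFactorizations (hF : IsSetLike F) :
    HasEpiMonoSourceFactorizations.{w} X := by
  intro s
  let r : Setoid (F.obj s.dom) :=
    { r := fun x y => ∀ i, F.map (s.hom i) x = F.map (s.hom i) y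
      iseqv := ⟨fun _ _ => rfl, fun h i => (h i).symm, fun h k i => (h i).trans (k i)⟩ }
  obtain ⟨B, ⟨ε⟩⟩ := hF.exists_quotient s.dom r
  obtain ⟨e, he⟩ := hF.exists_map_eq fun x => ε.symm (Quotient.mk r x)
  choose m hm using fun i => hF.exists_map_eq fun y : F.obj B =>
    Quotient.lift (F.map (s.hom i)) (fun x y (h : r.r x y) => h i) (ε y)
  have hsurj : Function.Surjective (F.map e) := fun y => by
    obtain ⟨x, hx⟩ := Quotient.exists_rep (ε y)
    exact ⟨x, by rw [he, hx, Equiv.symm_apply_apply]⟩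
  have hem (i) (x) : F.map (m i) (F.map e x) = F.map (s.hom i) x := by
    rw [hm, he, Equiv.apply_symm_apply]
    rfl
  refine ⟨B, e, m, ⟨fun p q h => hF.hom_ext fun y => ?_⟩, fun Z p q h => hF.hom_ext fun z => ?_,
    fun i => hF.hom_ext fun x => by simpa using hem i x⟩
  · obtain ⟨x, rfl⟩ := hsurj y
    simpa using congrArg (fun k => F.map k x) h
  · obtain ⟨x, hx⟩ := hsurj (F.map p z)
    obtain ⟨y, hy⟩ := hsurj (F.map q z)
    rw [← hx, ← hy, he, he]
    congr 1
    refine Quotient.sound fun i => ?_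
    rw [← hem, ← hem, hx, hy]
    simpa using congrArg (fun k => F.map k z) (h i)

end IsSetLike

theorem isSetLike_id : IsSetLike (𝟭 (Type u)) where
  full := inferInstance
  faithful := inferInstance
  exists_quotient _ r := ⟨Quotient r, ⟨Equiv.refl _⟩⟩
  exists_two := ⟨ULift Bool, ⟨Equiv.refl _⟩⟩

theorem isSetLike_fintypeCat_incl : IsSetLike FintypeCat.incl.{u} where
  full := inferInstance
  faithful := inferInstance
  exists_quotient A r :=
    have : Finite (FintypeCat.incl.obj A) := A.property
    ⟨FintypeCat.of (Quotient r), ⟨Equiv.refl _⟩⟩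
  exists_two := ⟨FintypeCat.of (ULift Bool), ⟨Equiv.refl _⟩⟩

end SetLike

theorem hasFiniteLimits_structured {X : Type u'} [Category.{v'} X] (S : X ⥤ JCPos.{u})
    [HasFiniteLimits X] : HasFiniteLimits (Structured S) :=
  ⟨fun J _ _ => hasLimitsOfShape_structured S J⟩

theorem hasFiniteColimits_structured {X : Type u'} [Category.{v'} X] (S : X ⥤ JCPos.{u})
    [HasFiniteColimits X] : HasFiniteColimits (Structured S) :=
  ⟨fun J _ _ => hasColimitsOfShape_structured S J⟩

end LatStr

theorem corollary8 :
    -- the base category of sets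
    (∀ S : Type u ⥤ JCPos.{u},
      -- completeness and cocompleteness
      (HasLimits (Structured S) ∧ HasColimits (Structured S)) ∧
      -- the discrete and indiscrete adjoints, and preservation of limits and colimits
      (Nonempty (discrete S ⊣ forg S) ∧ Nonempty (forg S ⊣ indiscrete S) ∧
        PreservesLimitsOfSize.{v, w} (forg S) ∧ PreservesColimitsOfSize.{v, w} (forg S)) ∧
      -- limits are the initial lifts of the underlying limits
      (∀ (J : Type w) [Category.{v} J] (D : J ⥤ Structured S),
        (∀ l : Cone (D ⋙ forg S), Nonempty (IsLimit l) →
          Nonempty (IsLimit (initialLift S D l)) ∧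
          (Source.ofCone (initialLift S D l)).IsInitial (forg S)) ∧
        (∀ L : Cone D, Nonempty (IsLimit L) →
          Nonempty (IsLimit ((forg S).mapCone L)) ∧
          L.pt.str = ⨅ i, (assoc S).map (L.π.app i).base.op (D.obj i).str)) ∧
      -- colimits are the final lifts of the underlying colimits
      (∀ (J : Type w) [Category.{v} J] (D : J ⥤ Structured S),
        (∀ c : Cocone (D ⋙ forg S), Nonempty (IsColimit c) →
          Nonempty (IsColimit (finalLift S D c)) ∧
          (Sink.ofCocone (finalLift S D c)).IsFinal (forg S)) ∧
        (∀ K : Cocone D, Nonempty (IsColimit K) →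
          Nonempty (IsColimit ((forg S).mapCocone K)) ∧
          K.pt.str = ⨆ i, S.map (K.ι.app i).base (D.obj i).str)) ∧
      -- wellpoweredness and cowellpoweredness
      (WellPowered.{u} (Structured S) ∧ WellPowered.{u} (Structured S)ᵒᵖ) ∧
      -- (Epi, ExtremalMonoSource)-category
      IsEMCategory.{w} (MorphismProperty.epimorphisms (Structured S)) Source.IsExtremalMono ∧
      -- regular factorizations
      (IsEMCategory.{w} (MorphismProperty.regularEpi (Structured S)) Source.IsMono ∧
        IsEMStructured (MorphismProperty.regularEpi (Structured S))
          (MorphismProperty.monomorphisms (Structured S))) ∧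
      -- embeddings, extremal monomorphisms and regular monomorphisms coincide
      (∀ (A B : Structured S) (f : A ⟶ B),
        (IsEmbedding (forg S) f ↔ IsExtremalMono f) ∧ (IsExtremalMono f ↔ IsRegularMono f)) ∧
      -- quotient morphisms, extremal epimorphisms and regular epimorphisms coincide
      (∀ (A B : Structured S) (f : A ⟶ B),
        (IsQuotient (forg S) f ↔ ExtremalEpi f) ∧ (ExtremalEpi f ↔ IsRegularEpi f)) ∧
      -- separators and coseparators
      (HasSeparator (Structured S) ∧ HasCoseparator (Structured S))) ∧
    -- the base category of finite sets
    (∀ S : FintypeCat.{u} ⥤ JCPos.{u},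
      -- completeness and cocompleteness
      (HasFiniteLimits (Structured S) ∧ HasFiniteColimits (Structured S)) ∧
      -- the discrete and indiscrete adjoints, and preservation of limits and colimits
      (Nonempty (discrete S ⊣ forg S) ∧ Nonempty (forg S ⊣ indiscrete S) ∧
        PreservesLimitsOfSize.{v, w} (forg S) ∧ PreservesColimitsOfSize.{v, w} (forg S)) ∧
      -- limits are the initial lifts of the underlying limits
      (∀ (J : Type w) [Category.{v} J] (D : J ⥤ Structured S),
        (∀ l : Cone (D ⋙ forg S), Nonempty (IsLimit l) →
          Nonempty (IsLimit (initialLift S D l)) ∧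
          (Source.ofCone (initialLift S D l)).IsInitial (forg S)) ∧
        (∀ L : Cone D, Nonempty (IsLimit L) →
          Nonempty (IsLimit ((forg S).mapCone L)) ∧
          L.pt.str = ⨅ i, (assoc S).map (L.π.app i).base.op (D.obj i).str)) ∧
      -- colimits are the final lifts of the underlying colimits
      (∀ (J : Type w) [Category.{v} J] (D : J ⥤ Structured S),
        (∀ c : Cocone (D ⋙ forg S), Nonempty (IsColimit c) →
          Nonempty (IsColimit (finalLift S D c)) ∧
          (Sink.ofCocone (finalLift S D c)).IsFinal (forg S)) ∧
        (∀ K : Cocone D, Nonempty (IsColimit K) →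
          Nonempty (IsColimit ((forg S).mapCocone K)) ∧
          K.pt.str = ⨆ i, S.map (K.ι.app i).base (D.obj i).str)) ∧
      -- wellpoweredness and cowellpoweredness
      (WellPowered.{u} (Structured S) ∧ WellPowered.{u} (Structured S)ᵒᵖ) ∧
      -- (Epi, ExtremalMonoSource)-category
      IsEMCategory.{w} (MorphismProperty.epimorphisms (Structured S)) Source.IsExtremalMono ∧
      -- regular factorizations
      (IsEMCategory.{w} (MorphismProperty.regularEpi (Structured S)) Source.IsMono ∧
        IsEMStructured (MorphismProperty.regularEpi (Structured S))
          (MorphismProperty.monomorphisms (Structured S))) ∧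
      -- embeddings, extremal monomorphisms and regular monomorphisms coincide
      (∀ (A B : Structured S) (f : A ⟶ B),
        (IsEmbedding (forg S) f ↔ IsExtremalMono f) ∧ (IsExtremalMono f ↔ IsRegularMono f)) ∧
      -- quotient morphisms, extremal epimorphisms and regular epimorphisms coincide
      (∀ (A B : Structured S) (f : A ⟶ B),
        (IsQuotient (forg S) f ↔ ExtremalEpi f) ∧ (ExtremalEpi f ↔ IsRegularEpi f)) ∧
      -- separators and coseparators
      (HasSeparator (Structured S) ∧ HasCoseparator (Structured S))) := by
  -- Wellpoweredness of the bases and of their opposites is found by instance resolution, from the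
  -- separators and coseparators, balancedness, pullbacks and pushouts.
  have hset := isSetLike_id.{u}
  have hfin := isSetLike_fintypeCat_incl.{u}
  constructor
  · intro S
    have := hset.hasSeparator
    have := hset.hasCoseparator
    have := hset.isRegularMonoCategory
    have := hset.isRegularEpiCategory
    have hfac := hset.hasEpiMonoSourceFactorizations.{w}
    have hreg := isEMCategory_regularEpi_isMono S hfac
    exact ⟨⟨⟨fun J _ => hasLimitsOfShape_structured S J⟩,
        ⟨fun J _ => hasColimitsOfShape_structured S J⟩⟩,
      ⟨⟨discreteAdj S⟩, ⟨indiscreteAdj S⟩, forg_preservesLimits S, forg_preservesColimits S⟩,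
      fun J _ D => ⟨fun l ⟨hl⟩ => ⟨⟨isLimitInitialLift S hl⟩, initialLift_isInitial S D l⟩,
        fun L ⟨hL⟩ => ⟨nonempty_isLimit_mapCone S hL, str_eq_of_isLimit S hL⟩⟩,
      fun J _ D => ⟨fun c ⟨hc⟩ => ⟨⟨isColimitFinalLift S hc⟩, finalLift_isFinal S D c⟩,
        fun K ⟨hK⟩ => ⟨nonempty_isColimit_mapCocone S hK, str_eq_of_isColimit S hK⟩⟩,
      ⟨wellPowered_structured S, wellPowered_structured_op S⟩,
      isEMCategory_epimorphisms_isExtremalMono S hfac,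
      ⟨hreg, hreg.isEMStructured_monomorphisms⟩,
      fun A B f => isEmbedding_iff_isExtremalMono_iff_isRegularMono S f,
      fun A B f => isQuotient_iff_extremalEpi_iff_isRegularEpi S f,
      hasSeparator_structured S, hasCoseparator_structured S⟩
  · intro S
    have := hfin.hasSeparator
    have := hfin.hasCoseparator
    have := hfin.isRegularMonoCategory
    have := hfin.isRegularEpiCategory
    have hfac := hfin.hasEpiMonoSourceFactorizations.{w}
    have hreg := isEMCategory_regularEpi_isMono S hfac
    exact ⟨⟨hasFiniteLimits_structured S, hasFiniteColimits_structured S⟩,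
      ⟨⟨discreteAdj S⟩, ⟨indiscreteAdj S⟩, forg_preservesLimits S, forg_preservesColimits S⟩,
      fun J _ D => ⟨fun l ⟨hl⟩ => ⟨⟨isLimitInitialLift S hl⟩, initialLift_isInitial S D l⟩,
        fun L ⟨hL⟩ => ⟨nonempty_isLimit_mapCone S hL, str_eq_of_isLimit S hL⟩⟩,
      fun J _ D => ⟨fun c ⟨hc⟩ => ⟨⟨isColimitFinalLift S hc⟩, finalLift_isFinal S D c⟩,
        fun K ⟨hK⟩ => ⟨nonempty_isColimit_mapCocone S hK, str_eq_of_isColimit S hK⟩⟩,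
      ⟨wellPowered_structured S, wellPowered_structured_op S⟩,
      isEMCategory_epimorphisms_isExtremalMono S hfac,
      ⟨hreg, hreg.isEMStructured_monomorphisms⟩,
      fun A B f => isEmbedding_iff_isExtremalMono_iff_isRegularMono S f,
      fun A B f => isQuotient_iff_extremalEpi_iff_isRegularEpi S f,
      hasSeparator_structured S, hasCoseparator_structured S⟩
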